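/- Let $N\ge 2$ and let $\mathcal H_{d_1},\dots,\mathcal H_{d_N}$ be Hilbert spaces of finite dimensions $d_1,\dots,d_N$. For each $l\in\{1,\dots,N\}$ let $\kappa_l\ge 1$ be a real number and let $\{G^{(l)}_i\}_{i=0}^{d_l^2-1}$ be operators on $\mathcal H_{d_l}$ with $G^{(l)}_0=I$ and, for $i,j\ge 1$, $\operatorname{Tr}\big((G^{(l)}_i)^\dagger G^{(l)}_j\big)=\kappa_l\delta_{ij}$ and $\operatorname{Tr}(G^{(l)}_i)=0$. For an operator $\rho$ on $\mathcal H_{d_1}\otimes\cdots\otimes\mathcal H_{d_N}$ and a set of parties $S=\{r_1<\dots<r_k\}$, let $\mathcal T^{(S)}=\mathcal T^{(r_1\cdots r_k)}$ be the tensor of size $(d_{r_1}^2-1)\times\cdots\times(d_{r_k}^2-1)$ with entries $$t_{i_{r_1}\cdots i_{r_k}}=\prod_{l\in S}\frac{d_l}{\kappa_l}\;\operatorname{Tr}\big(\rho\,(O_1\otimes\cdots\otimes O_N)\big),\qquad O_l=G^{(l)}_{i_l}\ (l\in S),\quad O_l=I\ (l\notin S).$$ For a tensor $\mathcal A$ with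 modes $r_1<\dots<r_k$ of sizes $D_{r_1},\dots,D_{r_k}$ and $n\in\{1,\dots,k\}$, the $n$-mode vectorization $\mathrm{vec}_n(\mathcal A)$ is the column vector of length $D_{r_1}\cdots D_{r_k}$ whose entry at position $$\Big(\prod_{s=1}^{n}D_{r_s}\Big)\sum_{t=n+1}^{k}(i_{r_t}-1)\prod_{s=t+1}^{k}D_{r_s}+\sum_{t=1}^{n}(i_{r_t}-1)\prod_{s=t+1}^{n}D_{r_s}+1$$ is the entry of $\mathcal A$ with indices $i_{r_1},\dots,i_{r_k}$. If $R\mid C$ is a partition of the modes $\{1,\dots,N\}$ of a tensor $\mathcal A$ into two nonempty sets, $n\in\{1,\dots,|R|\}$ and $m\in\{1,\dots,|C|\}$, the mixed unfolding $\mathbf A_{(R,n;C,m)}$ is the matrix that contains the entry of $\mathcal A$ with indices $i_1,\dots,i_N$ in the row given by this position formula for $R$, $n$ and the indices $(i_l)_{l\in R}$, and in the column given by the formula for $C$, $m$ and $(i_l)_{l\in C}$. For a nonempty set $S$ of $k$ parties put $D=\prod_{l\in S}d_l$, $K=\prod_{l\in S}\kappa_l$, $d=\max_{l\in S}d_l$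 and $$\mathfrak m^{(S)}=\begin{cases}\dfrac{d_l^2-d_l}{\kappa_l}, & S=\{l\},\\[2mm] \dfrac DK\Big(D+\dfrac1{k-1}-\dfrac D{k-1}\displaystyle\sum_{l\in S}\dfrac1{d_l^2}\Big), & k=2,\text{ or }k\ge3\text{ and }\dfrac D{d^2}<1,\\[2mm] \dfrac DK\Big(D+\dfrac2{k-2}-\dfrac D{k-2}\displaystyle\sum_{l\in S}\dfrac1{d_l^2}\Big), & k\ge3\text{ and }\dfrac D{d^2}\ge1.\end{cases}$$ Let $R=\{l_1<\dots<l_k\}$ and $C=\{l_{k+1}<\dots<l_N\}$ be a partition of $\{1,\dots,N\}$ into two nonempty sets, let $n\in\{1,\dots,k\}$ and $m\in\{1,\dots,N-k\}$, and let $u\in\mathbb R^{p_1}$, $v\in\mathbb R^{p_2}$, $\alpha\in\mathbb R^{q_1}$, $\beta\in\mathbb R^{q_2}$ be arbitrary vectors. The extended correlation tensor of $\rho$ under $R\mid C$ is the block matrix $$\mathcal M^{(l_1\cdots l_k|l_{k+1}\cdots l_N)}_{u,v,\alpha,\beta}(\rho)=\begin{pmatrix} uv^{\mathrm T} & u\,\big(\beta\otimes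 \mathrm{vec}_m(\mathcal T^{(C)})\big)^{\mathrm T}\\ \big(\alpha\otimes\mathrm{vec}_n(\mathcal T^{(R)})\big)v^{\mathrm T} & \alpha\beta^{\mathrm T}\otimes \mathbf T^{(1\cdots N)}_{(R,n;C,m)}\end{pmatrix},$$ where $\otimes$ is the Kronecker product. Suppose that $\rho$ is biseparable under $R\mid C$, that is, $\rho=\sum_i p_i\,\rho_i^{(l_1\cdots l_k)}\otimes\rho_i^{(l_{k+1}\cdots l_N)}$ is a finite convex combination of products of pure states of the two parts (each factor acting on the parties of its part). Then, with $\|A\|_{\mathrm{tr}}=\operatorname{Tr}\big((A^\dagger A)^{1/2}\big)$ and with Euclidean norms of vectors, $$\big\|\mathcal M^{(l_1\cdots l_k|l_{k+1}\cdots l_N)}_{u,v,\alpha,\beta}(\rho)\big\|_{\mathrm{tr}}\le\sqrt{\|u\|^2+\|\alpha\|^2\,\mathfrak m^{(l_1\cdots l_k)}}\;\sqrt{\|v\|^2+\|\beta\|^2\,\mathfrak m^{(l_{k+1}\cdots l_N)}}.$$ -/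

import Mathlib

open scoped Matrix Kronecker MatrixOrder

noncomputable section

namespace Bisep

/-! ### Trace norm -/

/-- The trace norm `Tr ((Aᴴ A)^{1/2})` of a rectangular complex matrix. -/
def traceNorm {m n : Type*} [Fintype m] [Fintype n] [DecidableEq n] (A : Matrix m n ℂ) : ℝ :=
  (Matrix.trace (CFC.sqrt (Aᴴ * A))).re

/-! ### Vectorizations and mixed mode unfoldings of tensors

A tensor whose modes are the elements `l` of a finite set `S` of parties, mode `l` having size
`D l`, is a function `((l : S) → Fin (D l)) → ℂ`.  The elements of `S` are listed increasingly as
`r_1 < ⋯ < r_k` by `S.orderIsoOfFin`, and the mode number `n ∈ {1, …, k}` is represented by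
`n - 1 : Fin S.card`.  All indices start at `0` instead of `1`. -/

section Unfolding

variable {N : ℕ}

/-- The `j`-th element (from `0`) of `S` in increasing order. -/
def nth (S : Finset (Fin N)) (j : Fin S.card) : S := S.orderIsoOfFin rfl j

/-- The list of the modes `r_n, r_{n-1}, …, r_1, r_k, r_{k-1}, …, r_{n+1}` of `S`. -/
def modeOrder (S : Finset (Fin N)) (n : Fin S.card) : Fin S.card ≃ S :=
  haveI : NeZero S.card := ⟨by have := n.2; omega⟩
  (Equiv.subLeft n).trans (S.orderIsoOfFin rfl).toEquiv

/-- The bijection between multi-indices and positions in the `n`-mode vectorization: positions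
are written in mixed radix, where mode `r_n` runs fastest, followed by
`r_{n-1}, …, r_1, r_k, …, r_{n+1}`. -/
def modePos (D : Fin N → ℕ) (S : Finset (Fin N)) (n : Fin S.card) :
    ((l : S) → Fin (D l)) ≃ Fin (∏ l : S, D l) :=
  ((Equiv.piCongrLeft (fun l : S => Fin (D l)) (modeOrder S n)).symm.trans
    finPiFinEquiv).trans (finCongr (Equiv.prod_comp (modeOrder S n) fun l : S => D l))

/-- The position of a multi-index in the `n`-mode vectorization, written out (the sizes and indices
of the modes being listed in increasing order of the modes). -/
theorem modePos_apply (D : Fin N → ℕ) (S : Finset (Fin N)) (n : Fin S.card)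
    (i : (l : S) → Fin (D l)) :
    (modePos D S n i : ℕ) =
      (∏ a ∈ Finset.Iic n, D (nth S a)) *
          ∑ a ∈ Finset.Ioi n, (i (nth S a) : ℕ) * ∏ b ∈ Finset.Ioi a, D (nth S b) +
        ∑ a ∈ Finset.Iic n, (i (nth S a) : ℕ) * ∏ b ∈ Finset.Ioc a n, D (nth S b) := by
  have : NeZero S.card := ⟨by have := n.2; omega⟩
  have h1 : ∀ j, modeOrder S n j = nth S (n - j) := fun j => rfl
  have hprod : ∀ a : Fin S.card, ∏ x : Fin ((n - a : Fin S.card) : ℕ),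
      D (nth S (n - Fin.castLE (n - a).is_lt.le x)) =
      ∏ b ∈ Finset.univ.filter (fun b => n - b < n - a), D (nth S b) := by
    intro a
    refine Finset.prod_bij (fun x _ => n - Fin.castLE (n - a).is_lt.le x) ?_ ?_ ?_ ?_
    · intro x _
      rw [Finset.mem_filter, sub_sub_cancel]
      exact ⟨Finset.mem_univ _, x.2⟩
    · intro x _ y _ h
      simpa using h
    · intro b hb
      have hb := (Finset.mem_filter.1 hb).2
      exact ⟨⟨_, hb⟩, Finset.mem_univ _, by simp [Fin.castLE]⟩
    · intro x _; rfl
  have key : (modePos D S n i : ℕ) = ∑ a : Fin S.card, (i (nth S a) : ℕ) *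
      ∏ b ∈ Finset.univ.filter (fun b => n - b < n - a), D (nth S b) := by
    simp only [modePos, Equiv.trans_apply, finCongr_apply, Fin.val_cast, finPiFinEquiv_apply]
    rw [← Equiv.sum_comp (Equiv.subLeft n)]
    refine Finset.sum_congr rfl fun a _ => ?_
    rw [← hprod]
    have h2 : modeOrder S n (Equiv.subLeft n a) = nth S a := by
      rw [h1]; simp
    have h3 : ∀ l l' : S, l = l' → (i l : ℕ) = i l' := by rintro l _ rfl; rfl
    have h4 := h3 _ _ h2
    simp only [h1] at h4 ⊢
    exact congrArg₂ (· * ·) h4 rfl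
  have hlt : ∀ a b : Fin S.card, n - b < n - a ↔
      if n < a then (b ≤ n ∨ a < b) else (a < b ∧ b ≤ n) := by
    intro a b
    simp only [Fin.lt_def, Fin.le_def]
    have hn := n.2; have ha := a.2; have hb := b.2
    have e : ∀ x : Fin S.card, ((n - x : Fin S.card) : ℕ) =
        if n.val < x.val then S.card + n - x else n - x := by
      intro x
      have hx := x.2
      rw [Fin.val_sub]
      split_ifs with h
      · rw [Nat.mod_eq_of_lt (by omega)]; omega
      · rw [show S.card - (x:ℕ) + n = (n - x) + S.card by omega, Nat.add_mod_right,
          Nat.mod_eq_of_lt (by omega)]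
    rw [e, e]
    split_ifs <;> omega
  rw [key, ← Finset.sum_filter_add_sum_filter_not Finset.univ (fun a => n < a), Finset.mul_sum]
  congr 1
  · refine Finset.sum_congr (by ext; simp) fun a ha => ?_
    have ha' : n < a := by simpa using ha
    rw [mul_left_comm, ← Finset.prod_union]
    · congr 2
      ext b; simp [hlt, ha']
    · rw [Finset.disjoint_left]; intro b; simp; omega
  · refine Finset.sum_congr (by ext; simp) fun a ha => ?_
    have ha' : ¬ n < a := by simpa using ha
    congr 2
    ext b; simp [hlt, ha']

/-- The `n`-mode vectorization of a tensor. -/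
def modeVec {D : Fin N → ℕ} {S : Finset (Fin N)} (n : Fin S.card)
    (A : ((l : S) → Fin (D l)) → ℂ) : Fin (∏ l : S, D l) → ℂ :=
  fun x => A ((modePos D S n).symm x)

/-- The multi-index which is `a` on `S` and `b` on the complement of `S`. -/
def combine {D : Fin N → ℕ} {S : Finset (Fin N)} (a : (l : S) → Fin (D l))
    (b : (l : (Sᶜ : Finset (Fin N))) → Fin (D l)) : (l : Fin N) → Fin (D l) :=
  fun l => if h : l ∈ S then a ⟨l, h⟩ else b ⟨l, Finset.mem_compl.2 h⟩

/-- The mixed `(R, n; C, m)`-mode matrix unfolding of a tensor with modes `1, …, N`,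
for `R = S` and `C = Sᶜ`. -/
def mixedUnfold {D : Fin N → ℕ} {S : Finset (Fin N)} (n : Fin S.card) (m : Fin (Sᶜ).card)
    (A : ((l : Fin N) → Fin (D l)) → ℂ) :
    Matrix (Fin (∏ l : S, D l)) (Fin (∏ l : (Sᶜ : Finset (Fin N)), D l)) ℂ :=
  fun x y => A (combine ((modePos D S n).symm x) ((modePos D Sᶜ m).symm y))

end Unfolding

/-! ### States and biseparability

An operator on `⨂_{l ∈ ι} ℂ^{d l}` is a matrix whose rows and columns are indexed by
`(l : ι) → Fin (d l)` (the product basis). -/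

/-- `ρ` is a pure state `|ψ⟩⟨ψ|` with a unit vector `ψ`. -/
def IsPureState {m : Type*} [Fintype m] (ρ : Matrix m m ℂ) : Prop :=
  ∃ ψ : m → ℂ, star ψ ⬝ᵥ ψ = 1 ∧ ρ = Matrix.vecMulVec ψ (star ψ)

section Systems

variable {N : ℕ} {d : Fin N → ℕ}

/-- The tensor product of an operator on the parties in `S` and one on the remaining parties,
as an operator on all parties (in their original order). -/
def bipartiteProd {S : Finset (Fin N)}
    (A : Matrix ((l : S) → Fin (d l)) ((l : S) → Fin (d l)) ℂ)
    (B : Matrix ((l : (Sᶜ : Finset (Fin N))) → Fin (d l))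
      ((l : (Sᶜ : Finset (Fin N))) → Fin (d l)) ℂ) :
    Matrix ((l : Fin N) → Fin (d l)) ((l : Fin N) → Fin (d l)) ℂ :=
  fun x y => A (fun l => x l) (fun l => y l) * B (fun l => x l) (fun l => y l)

/-- `ρ` is biseparable under the bipartition `S | Sᶜ`: it is a finite convex combination of
products of pure states of the two parts. -/
def IsBiseparable (S : Finset (Fin N))
    (ρ : Matrix ((l : Fin N) → Fin (d l)) ((l : Fin N) → Fin (d l)) ℂ) : Prop :=
  ∃ (r : ℕ) (p : Fin r → ℝ)
    (A : Fin r → Matrix ((l : S) → Fin (d l)) ((l : S) → Fin (d l)) ℂ)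
    (B : Fin r → Matrix ((l : (Sᶜ : Finset (Fin N))) → Fin (d l))
      ((l : (Sᶜ : Finset (Fin N))) → Fin (d l)) ℂ),
    (∀ i, 0 ≤ p i) ∧ ∑ i, p i = 1 ∧ (∀ i, IsPureState (A i)) ∧ (∀ i, IsPureState (B i)) ∧
      ρ = ∑ i, (p i : ℂ) • bipartiteProd (A i) (B i)

/-! ### Operator bases and correlation tensors -/

/-- `G 0 = I`, the other `d² - 1` operators are traceless and pairwise orthogonal for the
Hilbert-Schmidt inner product, with squared norm `κ`. -/
structure IsOperatorBasis {d : ℕ} (G : Fin (d ^ 2 - 1 + 1) → Matrix (Fin d) (Fin d) ℂ)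
    (κ : ℝ) : Prop where
  zero : G 0 = 1
  inner : ∀ i j : Fin (d ^ 2 - 1),
    Matrix.trace ((G i.succ)ᴴ * G j.succ) = if i = j then (κ : ℂ) else 0
  traceless : ∀ i : Fin (d ^ 2 - 1), Matrix.trace (G i.succ) = 0

/-- The adjoints of an operator basis form an operator basis with the same constant.  The coefficient
of `ρ` at a basis element `G` is `Tr (ρ Gᴴ)` up to a factor, so the tensors of `ρ` that are built
below from `Tr (ρ G)` for all bases `G` include the families of these coefficients. -/
theorem IsOperatorBasis.conjTranspose {d : ℕ}
    {G : Fin (d ^ 2 - 1 + 1) → Matrix (Fin d) (Fin d) ℂ} {κ : ℝ} (h : IsOperatorBasis G κ) :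
    IsOperatorBasis (fun i => (G i)ᴴ) κ where
  zero := by simp [h.zero]
  inner i j := by
    rw [Matrix.conjTranspose_conjTranspose, Matrix.trace_mul_comm, h.inner]
    simp only [eq_comm]
  traceless i := by rw [Matrix.trace_conjTranspose, h.traceless, star_zero]

/-- The tensor product `O_1 ⊗ ⋯ ⊗ O_N`. -/
def tensorOp (O : (l : Fin N) → Matrix (Fin (d l)) (Fin (d l)) ℂ) :
    Matrix ((l : Fin N) → Fin (d l)) ((l : Fin N) → Fin (d l)) ℂ :=
  fun x y => ∏ l, O l (x l) (y l)

/-- The tensor `T^{(r_1 ⋯ r_p)}` of `ρ` for the set of parties `S = {r_1, …, r_p}`, with entries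
`∏_{l ∈ S} (d_l / κ_l) * Tr (ρ (O_1 ⊗ ⋯ ⊗ O_N))`, where `O_l = G^{(l)}_{i_l}` for `l ∈ S` and
`O_l = I` otherwise.  The index `i` of the tensor corresponds to `i.succ` in the basis. -/
def reducedTensor (G : (l : Fin N) → Fin (d l ^ 2 - 1 + 1) → Matrix (Fin (d l)) (Fin (d l)) ℂ)
    (κ : Fin N → ℝ) (ρ : Matrix ((l : Fin N) → Fin (d l)) ((l : Fin N) → Fin (d l)) ℂ)
    (S : Finset (Fin N)) (i : (l : S) → Fin (d l ^ 2 - 1)) : ℂ :=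
  (∏ l ∈ S, ((d l : ℂ) / (κ l : ℂ))) *
    Matrix.trace (ρ * tensorOp fun l => if h : l ∈ S then G l (i ⟨l, h⟩).succ else 1)

/-- The correlation tensor `T^{(1 ⋯ N)}` of `ρ`. -/
def correlationTensor
    (G : (l : Fin N) → Fin (d l ^ 2 - 1 + 1) → Matrix (Fin (d l)) (Fin (d l)) ℂ)
    (κ : Fin N → ℝ) (ρ : Matrix ((l : Fin N) → Fin (d l)) ((l : Fin N) → Fin (d l)) ℂ)
    (i : (l : Fin N) → Fin (d l ^ 2 - 1)) : ℂ :=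
  (∏ l, ((d l : ℂ) / (κ l : ℂ))) * Matrix.trace (ρ * tensorOp fun l => G l (i l).succ)

/-- The Kronecker product of a real vector and a complex vector. -/
def vecKron {q : ℕ} {P : Type*} (a : EuclideanSpace ℝ (Fin q)) (t : P → ℂ) : Fin q × P → ℂ :=
  fun x => (a x.1 : ℂ) * t x.2

/-- The extended correlation tensor of `ρ` under the bipartition `S | Sᶜ`. -/
def extendedTensor
    (G : (l : Fin N) → Fin (d l ^ 2 - 1 + 1) → Matrix (Fin (d l)) (Fin (d l)) ℂ)
    (κ : Fin N → ℝ) (ρ : Matrix ((l : Fin N) → Fin (d l)) ((l : Fin N) → Fin (d l)) ℂ)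
    (S : Finset (Fin N)) (n : Fin S.card) (m : Fin (Sᶜ).card)
    {p₁ p₂ q₁ q₂ : ℕ} (u : EuclideanSpace ℝ (Fin p₁)) (v : EuclideanSpace ℝ (Fin p₂))
    (α : EuclideanSpace ℝ (Fin q₁)) (β : EuclideanSpace ℝ (Fin q₂)) :
    Matrix (Fin p₁ ⊕ Fin q₁ × Fin (∏ l : S, (d l ^ 2 - 1)))
      (Fin p₂ ⊕ Fin q₂ × Fin (∏ l : (Sᶜ : Finset (Fin N)), (d l ^ 2 - 1))) ℂ :=
  let uC : Fin p₁ → ℂ := fun i => (u i : ℂ)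
  let vC : Fin p₂ → ℂ := fun i => (v i : ℂ)
  let αC : Fin q₁ → ℂ := fun i => (α i : ℂ)
  let βC : Fin q₂ → ℂ := fun i => (β i : ℂ)
  let tR := modeVec (D := fun l => d l ^ 2 - 1) n (reducedTensor G κ ρ S)
  let tC := modeVec (D := fun l => d l ^ 2 - 1) m (reducedTensor G κ ρ Sᶜ)
  let T := mixedUnfold (D := fun l => d l ^ 2 - 1) n m (correlationTensor G κ ρ)
  Matrix.fromBlocks
    (Matrix.vecMulVec uC vC) (Matrix.vecMulVec uC (vecKron β tC))
    (Matrix.vecMulVec (vecKron α tR) vC) (Matrix.vecMulVec αC βC ⊗ₖ T)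

/-- The constant `𝔪^{(l_1 ⋯ l_k)}` of the nonempty set of parties `S = {l_1, …, l_k}`. -/
def mConst (d : Fin N → ℕ) (κ : Fin N → ℝ) (S : Finset (Fin N)) : ℝ :=
  let k : ℝ := (S.card : ℝ)
  let D : ℝ := ∏ l ∈ S, (d l : ℝ)
  let K : ℝ := ∏ l ∈ S, κ l
  let dmax : ℕ := S.sup d
  let invSq : ℝ := ∑ l ∈ S, 1 / (d l : ℝ) ^ 2
  if S.card = 1 then ∑ l ∈ S, ((d l : ℝ) ^ 2 - (d l : ℝ)) / κ l
  else if S.card = 2 ∨ D / (dmax : ℝ) ^ 2 < 1 then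
    D / K * (D + 1 / (k - 1) - D / (k - 1) * invSq)
  else D / K * (D + 2 / (k - 2) - D / (k - 2) * invSq)

end Systems

end Bisep

end

/-! The extended tensor of a product of pure states is a rank-one matrix `x yᵀ`, with `x = (u, α ⊗
t_R)` and `y = (v, β ⊗ t_C)`, where `t_R` and `t_C` vectorize the full correlation tensors of the
two factors. The identity component of a state is its trace, so the mixed blocks factor as well. For
a biseparable state this gives a convex combination of rank-one matrices
(`extendedTensor_sum_bipartiteProd`), whose trace norm is at most the weighted sum of the `‖x‖ ‖y‖`
(`traceNorm_sum_vecMulVec_le`). Vectorization only permutes entries, so it remains to bound the norm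
of the full correlation tensor of a pure state by `mConst` (`sum_sq_norm_localTensor_le_mConst`).

For that bound, let `k` be the number of parties, `D` the total dimension and `f i` the normalized
squared Bloch coefficients (`blochWeight`). They are nonnegative, sum to `1`, and `f 0 = 1/D`. The
quantity to bound is `E`, the sum of `f` over the indices with no zero entry. Write `P_l` for the
sum over the indices vanishing at `l` and `Q_l` for the sum over those vanishing away from `l`.
Complementary reductions of a pure state have equal purity, so `D Q_l = d_l² P_l`; since `Q_l ≥ f
0`, also `P_l ≥ 1/d_l²`. On the other hand `∑ P_l` counts each `f i` once per zero of `i`. Comparing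
the two, with `∑ Q_l` subtracted when every `d_l² ≤ D`, gives the upper bounds on `E`. -/

noncomputable section

namespace Bisep

/-! ### Trace norm of sums of rank-one matrices -/

section TraceNorm

open scoped ComplexOrder

variable {m n : Type*} [Fintype m] [Fintype n] [DecidableEq n]

omit [DecidableEq n] in
theorem inner_toLp_mulVec (A : Matrix m n ℂ) (a b : n → ℂ) :
    inner ℂ (WithLp.toLp 2 (A *ᵥ a)) (WithLp.toLp 2 (A *ᵥ b)) =
      inner ℂ (WithLp.toLp 2 a) (WithLp.toLp 2 ((Aᴴ * A) *ᵥ b)) := by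
  simp only [EuclideanSpace.inner_eq_star_dotProduct]
  rw [dotProduct_comm, Matrix.star_mulVec, ← Matrix.dotProduct_mulVec, Matrix.mulVec_mulVec,
    dotProduct_comm]

/-- A truncated singular value decomposition: the trace norm is the sum of the diagonal entries
of `A` between two orthonormal families. -/
theorem exists_orthonormal_traceNorm_eq (A : Matrix m n ℂ) :
    ∃ (J : Finset n) (f : J → EuclideanSpace ℂ m) (e : OrthonormalBasis n ℂ (EuclideanSpace ℂ n)),
      Orthonormal ℂ f ∧
        traceNorm A = ∑ j : J, (inner ℂ (f j) (WithLp.toLp 2 (A *ᵥ (e j).ofLp))).re := by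
  have hQ : (CFC.sqrt (Aᴴ * A)).PosSemidef := Matrix.nonneg_iff_posSemidef.1 (CFC.sqrt_nonneg _)
  have hQQ : CFC.sqrt (Aᴴ * A) * CFC.sqrt (Aᴴ * A) = Aᴴ * A :=
    CFC.sqrt_mul_sqrt_self _ (Matrix.posSemidef_conjTranspose_mul_self A).nonneg
  unfold traceNorm
  set Q := CFC.sqrt (Aᴴ * A)
  let e := hQ.isHermitian.eigenvectorBasis
  let s := hQ.isHermitian.eigenvalues
  have hin : ∀ i j, inner ℂ (WithLp.toLp 2 (A *ᵥ (e i).ofLp)) (WithLp.toLp 2 (A *ᵥ (e j).ofLp)) =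
      if i = j then ((s j : ℂ)) ^ 2 else 0 := by
    intro i j
    have h : (Aᴴ * A) *ᵥ (e j).ofLp = ((s j : ℂ) ^ 2) • (e j).ofLp := by
      rw [← hQQ, ← Matrix.mulVec_mulVec, hQ.isHermitian.mulVec_eigenvectorBasis,
        Matrix.mulVec_smul, hQ.isHermitian.mulVec_eigenvectorBasis, smul_smul, ← sq]
      ext x
      simp [s, e]
    rw [inner_toLp_mulVec, h, WithLp.toLp_smul, inner_smul_right]
    have := orthonormal_iff_ite.1 e.orthonormal i j
    simp only [WithLp.toLp_ofLp, this]
    split_ifs <;> simp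
  -- The vectors `A e_j` are orthogonal with squared norms `s_j²`. Those with `s_j ≠ 0` can be
  -- normalized; the others contribute nothing to the trace of `Q`.
  refine ⟨Finset.univ.filter fun j => s j ≠ 0,
    fun j => ((s j : ℂ))⁻¹ • WithLp.toLp 2 (A *ᵥ (e j).ofLp), e, ?_, ?_⟩
  · rw [orthonormal_iff_ite]
    rintro ⟨i, hi⟩ ⟨j, hj⟩
    have hj' : (s j : ℂ) ≠ 0 := by simpa using hj
    simp only [inner_smul_left, inner_smul_right, hin, Subtype.mk.injEq]
    split_ifs with h
    · subst h
      simp only [map_inv₀, Complex.conj_ofReal]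
      field_simp
    · simp
  · rw [hQ.isHermitian.trace_eq_sum_eigenvalues]
    have h : ∀ j : ↥(Finset.univ.filter fun j => s j ≠ 0),
        (inner ℂ (((s j : ℂ))⁻¹ • WithLp.toLp 2 (A *ᵥ (e j).ofLp) : EuclideanSpace ℂ m)
          (WithLp.toLp 2 (A *ᵥ (e j).ofLp))).re = s j := by
      rintro ⟨j, hj⟩
      have hj' : s j ≠ 0 := by simpa using hj
      simp only [inner_smul_left, hin, if_true, map_inv₀, Complex.conj_ofReal]
      rw [← Complex.ofReal_inv, ← Complex.ofReal_pow, ← Complex.ofReal_mul, Complex.ofReal_re]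
      field_simp
    rw [Finset.sum_congr rfl fun j _ => h j, Finset.sum_coe_sort _ s, Finset.sum_filter_ne_zero]
    simp [s]

/-- The trace norm of a nonnegative combination of rank one matrices. -/
theorem traceNorm_sum_vecMulVec_le {r : Type*} [Fintype r] {p : r → ℝ} (hp : ∀ i, 0 ≤ p i)
    (x : r → m → ℂ) (y : r → n → ℂ) :
    traceNorm (∑ i, (p i : ℂ) • Matrix.vecMulVec (x i) (y i)) ≤
      ∑ i, p i * (√(∑ a, ‖x i a‖ ^ 2) * √(∑ b, ‖y i b‖ ^ 2)) := by
  obtain ⟨J, f, e, hf, h⟩ := exists_orthonormal_traceNorm_eq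
    (∑ i, (p i : ℂ) • Matrix.vecMulVec (x i) (y i))
  rw [h]
  have h1 : ∀ j : J, (inner ℂ (f j) (WithLp.toLp 2
      ((∑ i, (p i : ℂ) • Matrix.vecMulVec (x i) (y i)) *ᵥ (e j).ofLp))).re ≤
      ∑ i, p i * (‖inner ℂ (f j) (WithLp.toLp 2 (x i))‖ *
        ‖inner ℂ (e j) (WithLp.toLp 2 (star (y i)))‖) := by
    intro j
    have h2 : WithLp.toLp 2
      ((∑ i, (p i : ℂ) • Matrix.vecMulVec (x i) (y i)) *ᵥ (e j).ofLp) =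
        ∑ i, ((p i : ℂ) * (y i ⬝ᵥ (e j).ofLp)) • WithLp.toLp 2 (x i) := by
      ext a
      simp [Matrix.sum_mulVec, Matrix.smul_mulVec, Matrix.vecMulVec_mulVec, mul_assoc]
    rw [h2, inner_sum]
    refine (Complex.re_le_norm _).trans ((norm_sum_le _ _).trans (Finset.sum_le_sum fun i _ => ?_))
    have h3 : ‖inner ℂ (e j) (WithLp.toLp 2 (star (y i)))‖ = ‖y i ⬝ᵥ (e j).ofLp‖ := by
      rw [EuclideanSpace.inner_eq_star_dotProduct, Matrix.star_dotProduct_star, norm_star,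
        dotProduct_comm]
    rw [inner_smul_right, norm_mul, norm_mul, h3, Complex.norm_real, Real.norm_of_nonneg (hp i)]
    exact le_of_eq (by ring)
  refine (Finset.sum_le_sum fun j _ => h1 j).trans ?_
  rw [Finset.sum_comm]
  refine Finset.sum_le_sum fun i _ => ?_
  rw [← Finset.mul_sum]
  -- Cauchy–Schwarz over `j`, then Bessel's inequality for each of the two orthonormal families.
  refine mul_le_mul_of_nonneg_left ((Real.sum_mul_le_sqrt_mul_sqrt _ _ _).trans ?_) (hp i)
  have hx := hf.sum_inner_products_le (s := Finset.univ) (WithLp.toLp 2 (x i))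
  have hy : ∑ j : J, ‖inner ℂ (e j) (WithLp.toLp 2 (star (y i)))‖ ^ 2 ≤
      ‖WithLp.toLp 2 (star (y i))‖ ^ 2 :=
    (e.orthonormal.comp _ Subtype.val_injective).sum_inner_products_le
      (s := Finset.univ) (WithLp.toLp 2 (star (y i)))
  rw [EuclideanSpace.norm_sq_eq] at hx hy
  simp only [Pi.star_apply, norm_star] at hx hy
  gcongr

end TraceNorm

/-! ### Bloch coefficients and purities of reductions -/

section Bloch

/-- The squared Hilbert-Schmidt norm of the `j`-th element of an operator basis. -/
def basisWeight {d : ℕ} (κ : ℝ) (j : Fin (d ^ 2 - 1 + 1)) : ℝ := if j = 0 then d else κ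

theorem IsOperatorBasis.trace_conjTranspose_mul {d : ℕ}
    {G : Fin (d ^ 2 - 1 + 1) → Matrix (Fin d) (Fin d) ℂ} {κ : ℝ} (h : IsOperatorBasis G κ)
    (i j : Fin (d ^ 2 - 1 + 1)) :
    Matrix.trace ((G i)ᴴ * G j) = if i = j then ((basisWeight κ i : ℝ) : ℂ) else 0 := by
  refine Fin.cases ?_ (fun i => ?_) i <;> refine Fin.cases ?_ (fun j => ?_) j
  · simp [h.zero, basisWeight]
  · simp [h.zero, h.traceless, (Fin.succ_ne_zero j).symm]
  · simp [h.zero, h.traceless, Matrix.trace_conjTranspose]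
  · simp [h.inner, basisWeight]

/-- Orthogonality says that `U V = 1` for the matrices of conjugated and of normalized entries. Both
index sets have `d²` elements, so `V U = 1`, which is the completeness relation. -/
theorem IsOperatorBasis.completeness {d : ℕ} (hd : 0 < d)
    {G : Fin (d ^ 2 - 1 + 1) → Matrix (Fin d) (Fin d) ℂ} {κ : ℝ} (hκ : 0 < κ)
    (h : IsOperatorBasis G κ) (a b a' b' : Fin d) :
    ∑ j, ((basisWeight κ j : ℝ) : ℂ)⁻¹ * (G j a b * star (G j a' b')) =
      if a = a' ∧ b = b' then 1 else 0 := by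
  let U : Matrix (Fin (d ^ 2 - 1 + 1)) (Fin d × Fin d) ℂ := fun j x => star (G j x.1 x.2)
  let V : Matrix (Fin d × Fin d) (Fin (d ^ 2 - 1 + 1)) ℂ :=
    fun x j => ((basisWeight κ j : ℝ) : ℂ)⁻¹ * G j x.1 x.2
  have hw : ∀ j : Fin (d ^ 2 - 1 + 1), ((basisWeight κ j : ℝ) : ℂ) ≠ 0 := by
    intro j
    unfold basisWeight
    split_ifs
    · exact_mod_cast hd.ne'
    · exact_mod_cast hκ.ne'
  have hUV : U * V = 1 := by
    ext i j
    have := h.trace_conjTranspose_mul i j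
    have h2 : (U * V) i j = ((basisWeight κ j : ℝ) : ℂ)⁻¹ * Matrix.trace ((G i)ᴴ * G j) := by
      rw [Matrix.mul_apply, Fintype.sum_prod_type]
      simp only [Matrix.mul_apply, Matrix.trace, Matrix.diag_apply, U, V,
        Matrix.conjTranspose_apply, Finset.mul_sum]
      rw [Finset.sum_comm]
      exact Finset.sum_congr rfl fun _ _ => Finset.sum_congr rfl fun _ _ => by ring
    rw [h2, this, Matrix.one_apply]
    split_ifs with hij
    · subst hij
      exact inv_mul_cancel₀ (hw i)
    · simp
  have hcard : Fintype.card (Fin (d ^ 2 - 1 + 1)) = Fintype.card (Fin d × Fin d) := by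
    -- Positivity matters: the truncated `d ^ 2 - 1 + 1` equals `1`, not `d ^ 2`, when `d = 0`.
    have : 0 < d ^ 2 := by positivity
    simp only [Fintype.card_fin, Fintype.card_prod]
    rw [Nat.sub_add_cancel this, sq]
  have hVU := (Matrix.mul_eq_one_comm_of_card_eq _ _ _ hcard).1 hUV
  have := congrFun (congrFun hVU (a, b)) (a', b')
  rw [Matrix.mul_apply, Matrix.one_apply] at this
  simpa only [U, V, mul_assoc, Prod.mk.injEq] using this

variable {ι : Type*} [Fintype ι] [DecidableEq ι] {d : ι → ℕ}

/-- The tensor product of a family of operators. -/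
def piTensor (O : (l : ι) → Matrix (Fin (d l)) (Fin (d l)) ℂ) :
    Matrix ((l : ι) → Fin (d l)) ((l : ι) → Fin (d l)) ℂ :=
  fun x y => ∏ l, O l (x l) (y l)

/-- The normalized squared modulus of a Bloch coefficient. -/
def blochWeight (G : (l : ι) → Fin (d l ^ 2 - 1 + 1) → Matrix (Fin (d l)) (Fin (d l)) ℂ)
    (κ : ι → ℝ) (σ : Matrix ((l : ι) → Fin (d l)) ((l : ι) → Fin (d l)) ℂ)
    (i : (l : ι) → Fin (d l ^ 2 - 1 + 1)) : ℝ :=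
  (∏ l, basisWeight (κ l) (i l))⁻¹ * ‖Matrix.trace (σ * piTensor fun l => G l (i l))‖ ^ 2

variable {G : (l : ι) → Fin (d l ^ 2 - 1 + 1) → Matrix (Fin (d l)) (Fin (d l)) ℂ} {κ : ι → ℝ}

theorem blochWeight_nonneg (hκ : ∀ l, 0 < κ l)
    (σ : Matrix ((l : ι) → Fin (d l)) ((l : ι) → Fin (d l)) ℂ)
    (i : (l : ι) → Fin (d l ^ 2 - 1 + 1)) : 0 ≤ blochWeight G κ σ i := by
  refine mul_nonneg (inv_nonneg.2 (Finset.prod_nonneg fun l _ => ?_)) (by positivity)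
  unfold basisWeight
  split_ifs
  · positivity
  · exact (hκ l).le

/-- The multi-indices which vanish outside `B`. -/
def supportedOn (d : ι → ℕ) (B : Finset ι) : Finset ((l : ι) → Fin (d l ^ 2 - 1 + 1)) :=
  Fintype.piFinset fun l => if l ∈ B then Finset.univ else {0}

theorem mem_supportedOn {B : Finset ι} {i : (l : ι) → Fin (d l ^ 2 - 1 + 1)} :
    i ∈ supportedOn d B ↔ ∀ l, l ∉ B → i l = 0 := by
  simp only [supportedOn, Fintype.mem_piFinset]
  refine forall_congr' fun l => ?_
  split_ifs with h <;> simp [h]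

/-- The right-hand side is the squared Hilbert–Schmidt norm of the partial trace of `σ` over `Bᶜ`.
It factors over the parties: completeness supplies the factor at `l ∈ B`, while at `l ∉ B` only the
identity occurs and its weight `d l` cancels the prefactor. -/
theorem sum_blochWeight_supportedOn (hd : ∀ l, 0 < d l) (hκ : ∀ l, 0 < κ l)
    (hG : ∀ l, IsOperatorBasis (G l) (κ l))
    (σ : Matrix ((l : ι) → Fin (d l)) ((l : ι) → Fin (d l)) ℂ) (B : Finset ι) :
    ((∏ l ∈ Bᶜ, (d l : ℂ)) * ((∑ i ∈ supportedOn d B, blochWeight G κ σ i : ℝ) : ℂ)) =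
      ∑ x, ∑ y, ∑ x', ∑ y', σ x y * star (σ x' y') *
        ∏ l, (if l ∈ B then (if x l = x' l ∧ y l = y' l then 1 else 0)
          else (if x l = y l ∧ x' l = y' l then 1 else 0) : ℂ) := by
  have hfactor : ∀ (x y x' y' : (l : ι) → Fin (d l)) (l : ι),
      (if l ∈ B then (1 : ℂ) else d l) * ∑ j ∈ (if l ∈ B then Finset.univ else {0}),
        ((basisWeight (κ l) j : ℝ) : ℂ)⁻¹ * (G l j (y l) (x l) * star (G l j (y' l) (x' l))) =
      (if l ∈ B then (if x l = x' l ∧ y l = y' l then 1 else 0)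
          else (if x l = y l ∧ x' l = y' l then 1 else 0) : ℂ) := by
    intro x y x' y' l
    have hc := (hG l).completeness (hd l) (hκ l) (y l) (x l) (y' l) (x' l)
    have hd0 : (d l : ℂ) ≠ 0 := by exact_mod_cast (hd l).ne'
    by_cases h : l ∈ B
    · simp only [h, if_true, hc, one_mul, and_comm]
    · simp only [h, if_false, Finset.sum_singleton, (hG l).zero, basisWeight, if_true,
        Complex.ofReal_natCast, mul_inv_cancel_left₀ hd0, Matrix.one_apply]
      by_cases h1 : x l = y l <;> by_cases h2 : x' l = y' l <;> simp [h1, h2, eq_comm]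
  have hterm : ∀ i : (l : ι) → Fin (d l ^ 2 - 1 + 1), ((blochWeight G κ σ i : ℝ) : ℂ) =
      ∑ x, ∑ y, ∑ x', ∑ y', σ x y * star (σ x' y') *
        ∏ l, ((basisWeight (κ l) (i l) : ℝ) : ℂ)⁻¹ *
          (G l (i l) (y l) (x l) * star (G l (i l) (y' l) (x' l))) := by
    intro i
    have h1 : Matrix.trace (σ * piTensor fun l => G l (i l)) =
        ∑ x, ∑ y, σ x y * ∏ l, G l (i l) (y l) (x l) := by
      simp [Matrix.trace, Matrix.mul_apply, piTensor]
    have h2 : ((‖Matrix.trace (σ * piTensor fun l => G l (i l))‖ ^ 2 : ℝ) : ℂ) =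
        star (Matrix.trace (σ * piTensor fun l => G l (i l))) *
          Matrix.trace (σ * piTensor fun l => G l (i l)) := by
      rw [mul_comm, Complex.star_def, Complex.mul_conj, Complex.normSq_eq_norm_sq]
    rw [blochWeight, Complex.ofReal_mul, h2, h1]
    simp only [Finset.sum_mul, star_sum, Finset.mul_sum, star_mul', star_prod,
      Finset.prod_mul_distrib, Complex.ofReal_inv, Complex.ofReal_prod, Finset.prod_inv_distrib]
    refine Finset.sum_congr rfl fun x _ => Finset.sum_congr rfl fun y _ =>
      Finset.sum_congr rfl fun x' _ => Finset.sum_congr rfl fun y' _ => by ring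
  have hprod : ∏ l ∈ Bᶜ, (d l : ℂ) = ∏ l, if l ∈ B then (1 : ℂ) else d l := by
    rw [Finset.prod_ite]
    simp [Finset.compl_eq_univ_sdiff, Finset.sdiff_eq_filter]
  rw [Complex.ofReal_sum, Finset.sum_congr rfl fun i _ => hterm i]
  simp only [← hfactor, Finset.prod_mul_distrib (f := fun l => if l ∈ B then (1 : ℂ) else d l)]
  rw [← hprod]
  simp only [Finset.prod_univ_sum, Finset.mul_sum]
  rw [Finset.sum_comm]
  refine Finset.sum_congr rfl fun x _ => ?_
  rw [Finset.sum_comm]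
  refine Finset.sum_congr rfl fun y _ => ?_
  rw [Finset.sum_comm]
  refine Finset.sum_congr rfl fun x' _ => ?_
  rw [Finset.sum_comm]
  refine Finset.sum_congr rfl fun y' _ => ?_
  exact Finset.sum_congr rfl fun i _ => by ring

/-- For a pure state, the reductions to `B` and to its complement have the same purity. -/
theorem sum_blochWeight_compl (hd : ∀ l, 0 < d l) (hκ : ∀ l, 0 < κ l)
    (hG : ∀ l, IsOperatorBasis (G l) (κ l))
    {σ : Matrix ((l : ι) → Fin (d l)) ((l : ι) → Fin (d l)) ℂ} (hσ : IsPureState σ)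
    (B : Finset ι) :
    (∏ l ∈ Bᶜ, (d l : ℝ)) * ∑ i ∈ supportedOn d B, blochWeight G κ σ i =
      (∏ l ∈ B, (d l : ℝ)) * ∑ i ∈ supportedOn d Bᶜ, blochWeight G κ σ i := by
  have h1 := sum_blochWeight_supportedOn hd hκ hG σ B
  have h2 := sum_blochWeight_supportedOn hd hκ hG σ Bᶜ
  rw [compl_compl] at h2
  obtain ⟨ψ, -, rfl⟩ := hσ
  have h3 := h1.trans (Eq.trans ?_ h2.symm)
  · exact_mod_cast h3
  refine Finset.sum_congr rfl fun x _ => ?_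
  -- For `σ = ψψ†` the product `σ x y * star (σ x' y')` is invariant under exchanging `y` and `x'`,
  -- and this exchange turns the constraints for `B` into those for `Bᶜ`.
  rw [Finset.sum_comm]
  refine Finset.sum_congr rfl fun y _ => Finset.sum_congr rfl fun x' _ =>
    Finset.sum_congr rfl fun y' _ => ?_
  congr 1
  · simp only [Matrix.vecMulVec_apply, Pi.star_apply, star_mul', star_star]
    ring
  · refine Finset.prod_congr rfl fun l _ => ?_
    by_cases h : l ∈ B <;> simp [h]

theorem IsPureState.trace_eq_one {m : Type*} [Fintype m] {σ : Matrix m m ℂ}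
    (hσ : IsPureState σ) : σ.trace = 1 := by
  obtain ⟨ψ, h, rfl⟩ := hσ
  rw [Matrix.trace_vecMulVec, dotProduct_comm, h]

theorem IsPureState.nonempty {m : Type*} [Fintype m] {σ : Matrix m m ℂ}
    (hσ : IsPureState σ) : Nonempty m := by
  by_contra h
  rw [not_nonempty_iff] at h
  simpa [Matrix.trace] using hσ.trace_eq_one

theorem piTensor_one : piTensor (fun l : ι => (1 : Matrix (Fin (d l)) (Fin (d l)) ℂ)) = 1 := by
  ext x y
  simp only [piTensor, Matrix.one_apply, Finset.prod_ite_zero, Finset.prod_const_one]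
  simp [funext_iff]

theorem blochWeight_zero (hG : ∀ l, IsOperatorBasis (G l) (κ l))
    {σ : Matrix ((l : ι) → Fin (d l)) ((l : ι) → Fin (d l)) ℂ} (hσ : IsPureState σ) :
    blochWeight G κ σ 0 = (∏ l, (d l : ℝ))⁻¹ := by
  simp [blochWeight, (hG _).zero, piTensor_one, hσ.trace_eq_one, basisWeight]

theorem sum_blochWeight (hd : ∀ l, 0 < d l) (hκ : ∀ l, 0 < κ l)
    (hG : ∀ l, IsOperatorBasis (G l) (κ l))
    {σ : Matrix ((l : ι) → Fin (d l)) ((l : ι) → Fin (d l)) ℂ} (hσ : IsPureState σ) :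
    ∑ i, blochWeight G κ σ i = 1 := by
  have h := sum_blochWeight_compl hd hκ hG hσ Finset.univ
  have h1 : supportedOn d (Finset.univ : Finset ι) = Finset.univ := by
    ext; simp [mem_supportedOn]
  have h0 : supportedOn d (∅ : Finset ι) = {0} := by
    ext; simp [mem_supportedOn, funext_iff]
  have hD : ∏ l, (d l : ℝ) ≠ 0 := Finset.prod_ne_zero_iff.2 fun l _ => by exact_mod_cast (hd l).ne'
  rw [Finset.compl_univ, h1, h0, Finset.sum_singleton, blochWeight_zero hG hσ,
    mul_inv_cancel₀ hD] at h
  simpa using h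

theorem sum_blochWeight_singleton (hd : ∀ l, 0 < d l) (hκ : ∀ l, 0 < κ l)
    (hG : ∀ l, IsOperatorBasis (G l) (κ l))
    {σ : Matrix ((l : ι) → Fin (d l)) ((l : ι) → Fin (d l)) ℂ} (hσ : IsPureState σ) (l : ι) :
    (∏ l, (d l : ℝ)) * ∑ i ∈ supportedOn d {l}, blochWeight G κ σ i =
      (d l : ℝ) ^ 2 * ∑ i ∈ supportedOn d {l}ᶜ, blochWeight G κ σ i := by
  have h := sum_blochWeight_compl hd hκ hG hσ {l}
  rw [Finset.prod_singleton] at h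
  rw [← Finset.prod_mul_prod_compl {l}, Finset.prod_singleton, mul_assoc, h]
  ring

/-- The index `0` alone contributes `1/D` to the sum over `supportedOn d {l}`; the purity identity
transfers this lower bound to the complement. -/
theorem inv_sq_le_sum_blochWeight (hd : ∀ l, 0 < d l) (hκ : ∀ l, 0 < κ l)
    (hG : ∀ l, IsOperatorBasis (G l) (κ l))
    {σ : Matrix ((l : ι) → Fin (d l)) ((l : ι) → Fin (d l)) ℂ} (hσ : IsPureState σ) (l : ι) :
    1 / (d l : ℝ) ^ 2 ≤ ∑ i ∈ supportedOn d {l}ᶜ, blochWeight G κ σ i := by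
  have h := sum_blochWeight_singleton hd hκ hG hσ l
  have hD : 0 < ∏ l, (d l : ℝ) := Finset.prod_pos fun l _ => by exact_mod_cast hd l
  have h0 : blochWeight G κ σ 0 ≤ ∑ i ∈ supportedOn d {l}, blochWeight G κ σ i :=
    Finset.single_le_sum (fun i _ => blochWeight_nonneg hκ σ i) (by simp [mem_supportedOn])
  rw [blochWeight_zero hG hσ, inv_le_iff_one_le_mul₀' hD, h] at h0
  have := hd l
  rwa [div_le_iff₀' (by positivity)]

end Bloch

/-! ### Bounds on the full correlation tensor of a pure state -/

section CorrelationNorm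

variable {ι : Type*} [Fintype ι] [DecidableEq ι] {d : ι → ℕ}
  {G : (l : ι) → Fin (d l ^ 2 - 1 + 1) → Matrix (Fin (d l)) (Fin (d l)) ℂ} {κ : ι → ℝ}

/-- The number of vanishing entries of a multi-index. -/
def numZeros (i : (l : ι) → Fin (d l ^ 2 - 1 + 1)) : ℕ :=
  (Finset.univ.filter fun l => i l = 0).card

omit [DecidableEq ι] in
theorem numZeros_eq_zero {i : (l : ι) → Fin (d l ^ 2 - 1 + 1)} :
    numZeros i = 0 ↔ ∀ l, i l ≠ 0 := by
  simp [numZeros, Finset.filter_eq_empty_iff]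

omit [DecidableEq ι] in
theorem numZeros_eq_card {i : (l : ι) → Fin (d l ^ 2 - 1 + 1)} :
    numZeros i = Fintype.card ι ↔ i = 0 := by
  rw [numZeros, Finset.card_eq_iff_eq_univ, Finset.filter_eq_self]
  simp [funext_iff]

omit [DecidableEq ι] in
theorem numZeros_le (i : (l : ι) → Fin (d l ^ 2 - 1 + 1)) : numZeros i ≤ Fintype.card ι :=
  Finset.card_le_univ _

theorem exists_mem_supportedOn_singleton {i : (l : ι) → Fin (d l ^ 2 - 1 + 1)}
    (h : numZeros i + 1 = Fintype.card ι) : ∃ l, i ∈ supportedOn d {l} := by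
  have h1 : ((Finset.univ.filter fun l => i l = 0)ᶜ).card = 1 := by
    rw [Finset.card_compl, ← h, numZeros]
    omega
  obtain ⟨l, hl⟩ := Finset.card_eq_one.1 h1
  refine ⟨l, mem_supportedOn.2 fun l' hl' => ?_⟩
  rw [← hl] at hl'
  simpa using hl'

/-- Double counting: `i` occurs in the inner sum for `l` exactly when `i l = 0`. -/
theorem sum_sum_blochWeight (σ : Matrix ((l : ι) → Fin (d l)) ((l : ι) → Fin (d l)) ℂ) :
    ∑ l, ∑ i ∈ supportedOn d {l}ᶜ, blochWeight G κ σ i =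
      ∑ i, (numZeros i : ℝ) * blochWeight G κ σ i := by
  have h : ∀ l, ∑ i ∈ supportedOn d {l}ᶜ, blochWeight G κ σ i =
      ∑ i, if i l = 0 then blochWeight G κ σ i else 0 := by
    intro l
    rw [← Finset.sum_filter]
    refine Finset.sum_congr ?_ fun _ _ => rfl
    ext i
    simp [mem_supportedOn]
  rw [Finset.sum_congr rfl fun l _ => h l, Finset.sum_comm]
  refine Finset.sum_congr rfl fun i _ => ?_
  rw [← Finset.sum_filter, Finset.sum_const, nsmul_eq_mul, numZeros]

theorem sum_blochWeight_succ (σ : Matrix ((l : ι) → Fin (d l)) ((l : ι) → Fin (d l)) ℂ) :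
    ∑ j : (l : ι) → Fin (d l ^ 2 - 1), blochWeight G κ σ (fun l => (j l).succ) =
      ∑ i, if numZeros i = 0 then blochWeight G κ σ i else 0 := by
  rw [← Finset.sum_filter]
  refine Finset.sum_bij (fun j _ l => (j l).succ) ?_ ?_ ?_ fun _ _ => rfl
  · intro j _
    simp [numZeros_eq_zero]
  · intro j _ j' _ h
    ext l : 1
    exact Fin.succ_injective _ (congrFun h l)
  · intro i hi
    have hi' := numZeros_eq_zero.1 (Finset.mem_filter.1 hi).2
    exact ⟨fun l => (i l).pred (hi' l), Finset.mem_univ _, by ext l; simp⟩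

/-- Serves the one-party case: the index `0` has a zero entry, so its weight `1/D` is lost from the
total `1`. -/
theorem sum_blochWeight_succ_le [Nonempty ι] (hd : ∀ l, 0 < d l) (hκ : ∀ l, 0 < κ l)
    (hG : ∀ l, IsOperatorBasis (G l) (κ l))
    {σ : Matrix ((l : ι) → Fin (d l)) ((l : ι) → Fin (d l)) ℂ} (hσ : IsPureState σ) :
    ∑ j : (l : ι) → Fin (d l ^ 2 - 1), blochWeight G κ σ (fun l => (j l).succ) ≤
      1 - (∏ l, (d l : ℝ))⁻¹ := by
  rw [sum_blochWeight_succ, le_sub_iff_add_le, ← sum_blochWeight hd hκ hG hσ,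
    ← blochWeight_zero hG hσ, ← Fintype.sum_ite_eq' 0 (blochWeight G κ σ),
    ← Finset.sum_add_distrib]
  refine Finset.sum_le_sum fun i _ => ?_
  have := blochWeight_nonneg (G := G) hκ σ i
  have hk : Fintype.card ι ≠ 0 := Fintype.card_ne_zero
  by_cases h0 : i = 0
  · have := numZeros_eq_card.2 h0
    rw [if_neg (by omega), if_pos h0, zero_add]
  · rw [if_neg h0, add_zero]
    split_ifs <;> linarith

/-- A nonzero index has at most `k - 1` zeros and the index `0` has `k`, so `∑ P_l ≤ (k - 1)(1 - E)
+ f 0`. Combine with `P_l ≥ 1/d_l²`. -/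
theorem card_sub_one_mul_sum_blochWeight_succ_le (hd : ∀ l, 0 < d l) (hκ : ∀ l, 0 < κ l)
    (hG : ∀ l, IsOperatorBasis (G l) (κ l))
    {σ : Matrix ((l : ι) → Fin (d l)) ((l : ι) → Fin (d l)) ℂ} (hσ : IsPureState σ) :
    ((Fintype.card ι : ℝ) - 1) *
      ∑ j : (l : ι) → Fin (d l ^ 2 - 1), blochWeight G κ σ (fun l => (j l).succ) ≤
      ((Fintype.card ι : ℝ) - 1) + (∏ l, (d l : ℝ))⁻¹ - ∑ l, 1 / (d l : ℝ) ^ 2 := by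
  have h1 : ∑ l, 1 / (d l : ℝ) ^ 2 ≤ ∑ i, (numZeros i : ℝ) * blochWeight G κ σ i := by
    rw [← sum_sum_blochWeight]
    exact Finset.sum_le_sum fun l _ => inv_sq_le_sum_blochWeight hd hκ hG hσ l
  have h2 : ∑ i, (numZeros i : ℝ) * blochWeight G κ σ i ≤
      ∑ i, (((Fintype.card ι : ℝ) - 1) * (blochWeight G κ σ i -
        (if numZeros i = 0 then blochWeight G κ σ i else 0)) +
          if i = 0 then blochWeight G κ σ i else 0) := by
    refine Finset.sum_le_sum fun i _ => ?_
    have hf := blochWeight_nonneg (G := G) hκ σ i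
    have hz := numZeros_le i
    by_cases h0 : i = 0
    · have hc := numZeros_eq_card.2 h0
      by_cases hn : numZeros i = 0
      · rw [if_pos hn, if_pos h0, hn, Nat.cast_zero]
        linarith
      · rw [if_neg hn, if_pos h0, hc]
        linarith
    · have hc := mt numZeros_eq_card.1 h0
      by_cases hn : numZeros i = 0
      · simp [hn, h0]
      · rw [if_neg hn, if_neg h0, sub_zero, add_zero]
        refine mul_le_mul_of_nonneg_right ?_ hf
        rw [le_sub_iff_add_le]
        exact_mod_cast (show numZeros i + 1 ≤ Fintype.card ι by omega)
  rw [Finset.sum_add_distrib, ← Finset.mul_sum, Finset.sum_sub_distrib,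
    sum_blochWeight hd hκ hG hσ, ← sum_blochWeight_succ, Finset.sum_ite_eq',
    if_pos (Finset.mem_univ _), blochWeight_zero hG hσ] at h2
  linarith

/-- Subtracting `∑ Q_l` compensates for the indices with exactly `k - 1` zeros, so `k - 1` improves
to `k - 2`. The condition `d_l² ≤ D` makes `P_l - Q_l = P_l (1 - d_l²/D)` nondecreasing in `P_l`, so
that `P_l ≥ 1/d_l²` can be inserted. -/
theorem card_sub_two_mul_sum_blochWeight_succ_le (hd : ∀ l, 0 < d l) (hκ : ∀ l, 0 < κ l)
    (hG : ∀ l, IsOperatorBasis (G l) (κ l)) (hι : 2 ≤ Fintype.card ι)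
    (hD : ∀ l, (d l : ℝ) ^ 2 ≤ ∏ l, (d l : ℝ))
    {σ : Matrix ((l : ι) → Fin (d l)) ((l : ι) → Fin (d l)) ℂ} (hσ : IsPureState σ) :
    ((Fintype.card ι : ℝ) - 2) *
      ∑ j : (l : ι) → Fin (d l ^ 2 - 1), blochWeight G κ σ (fun l => (j l).succ) ≤
      ((Fintype.card ι : ℝ) - 2) + 2 * (∏ l, (d l : ℝ))⁻¹ - ∑ l, 1 / (d l : ℝ) ^ 2 := by
  have hD0 : 0 < ∏ l, (d l : ℝ) := Finset.prod_pos fun l _ => by exact_mod_cast hd l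
  have h1 : ∑ l, (1 / (d l : ℝ) ^ 2 - (∏ l, (d l : ℝ))⁻¹) ≤
      ∑ l, (∑ i ∈ supportedOn d {l}ᶜ, blochWeight G κ σ i -
        ∑ i ∈ supportedOn d {l}, blochWeight G κ σ i) := by
    refine Finset.sum_le_sum fun l _ => ?_
    have hP := inv_sq_le_sum_blochWeight hd hκ hG hσ l
    have hQ := sum_blochWeight_singleton hd hκ hG hσ l
    have hdl : 0 < (d l : ℝ) := by exact_mod_cast hd l
    set P := ∑ i ∈ supportedOn d {l}ᶜ, blochWeight G κ σ i
    set Q := ∑ i ∈ supportedOn d {l}, blochWeight G κ σ i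
    set D := ∏ l, (d l : ℝ)
    have hQ' : Q = (d l : ℝ) ^ 2 * D⁻¹ * P := by field_simp; linarith
    have h3 : 0 ≤ 1 - (d l : ℝ) ^ 2 * D⁻¹ := by
      rw [sub_nonneg, ← div_eq_mul_inv, div_le_one hD0]
      exact hD l
    calc 1 / (d l : ℝ) ^ 2 - D⁻¹ = 1 / (d l : ℝ) ^ 2 * (1 - (d l : ℝ) ^ 2 * D⁻¹) := by field_simp
      _ ≤ P * (1 - (d l : ℝ) ^ 2 * D⁻¹) := mul_le_mul_of_nonneg_right hP h3
      _ = P - Q := by rw [hQ']; ring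
  -- The inequality holds term by term. The coefficient `2 - k` gives equality at `i = 0`, which
  -- lies in all `k` sets `supportedOn d {l}`: `(k - 2) + (2 - k) + k = k`.
  have h2 : ∑ i, (numZeros i : ℝ) * blochWeight G κ σ i ≤
      ∑ i, (((Fintype.card ι : ℝ) - 2) * (blochWeight G κ σ i -
        (if numZeros i = 0 then blochWeight G κ σ i else 0)) +
        (2 - (Fintype.card ι : ℝ)) * (if i = 0 then blochWeight G κ σ i else 0) +
          ∑ l, if i ∈ supportedOn d {l} then blochWeight G κ σ i else 0) := by
    refine Finset.sum_le_sum fun i _ => ?_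
    have hf := blochWeight_nonneg (G := G) hκ σ i
    have hz := numZeros_le i
    have hs : 0 ≤ ∑ l, if i ∈ supportedOn d {l} then blochWeight G κ σ i else 0 :=
      Finset.sum_nonneg fun l _ => by split_ifs <;> simp [hf]
    by_cases h0 : i = 0
    · have hc := numZeros_eq_card.2 h0
      have hsum : (∑ l, if i ∈ supportedOn d {l} then blochWeight G κ σ i else 0) =
          Fintype.card ι * blochWeight G κ σ i := by
        have : ∀ l, i ∈ supportedOn d {l} := fun l => by simp [h0, mem_supportedOn]
        simp [this]
      rw [hsum, if_neg (by omega), if_pos h0, hc]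
      linarith
    · have hc := mt numZeros_eq_card.1 h0
      rw [if_neg h0, mul_zero, add_zero]
      by_cases hn : numZeros i = 0
      · simpa [hn] using hs
      rw [if_neg hn, sub_zero]
      by_cases h1 : numZeros i + 1 = Fintype.card ι
      · obtain ⟨l, hl⟩ := exists_mem_supportedOn_singleton h1
        have hge : blochWeight G κ σ i ≤
            ∑ l, if i ∈ supportedOn d {l} then blochWeight G κ σ i else 0 := by
          refine le_trans ?_ (Finset.single_le_sum (fun l _ => ?_) (Finset.mem_univ l))
          · rw [if_pos hl]
          · split_ifs <;> simp [hf]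
        have h1' : (numZeros i : ℝ) = Fintype.card ι - 1 := by
          rw [← h1]; push_cast; ring
        rw [h1']
        linarith
      · have : (numZeros i : ℝ) ≤ Fintype.card ι - 2 := by
          rw [le_sub_iff_add_le]
          exact_mod_cast (show numZeros i + 2 ≤ Fintype.card ι by omega)
        have := mul_le_mul_of_nonneg_right this hf
        linarith
  have hQ : ∑ i, ∑ l, (if i ∈ supportedOn d {l} then blochWeight G κ σ i else 0) =
      ∑ l, ∑ i ∈ supportedOn d {l}, blochWeight G κ σ i := by
    rw [Finset.sum_comm]
    simp [Finset.sum_ite_mem]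
  rw [Finset.sum_add_distrib, Finset.sum_add_distrib, ← Finset.mul_sum, ← Finset.mul_sum,
    Finset.sum_sub_distrib, hQ, sum_blochWeight hd hκ hG hσ, ← sum_blochWeight_succ,
    Finset.sum_ite_eq', if_pos (Finset.mem_univ _), blochWeight_zero hG hσ] at h2
  rw [Finset.sum_sub_distrib, Finset.sum_sub_distrib, sum_sum_blochWeight, Finset.sum_const,
    Finset.card_univ, nsmul_eq_mul] at h1
  linarith

/-- The entries of the full correlation tensor of a state of the parties `ι`. -/
def localTensor (G : (l : ι) → Fin (d l ^ 2 - 1 + 1) → Matrix (Fin (d l)) (Fin (d l)) ℂ)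
    (κ : ι → ℝ) (σ : Matrix ((l : ι) → Fin (d l)) ((l : ι) → Fin (d l)) ℂ)
    (i : (l : ι) → Fin (d l ^ 2 - 1)) : ℂ :=
  (∏ l, ((d l : ℂ) / (κ l : ℂ))) * Matrix.trace (σ * piTensor fun l => G l (i l).succ)

theorem sum_sq_norm_localTensor (hκ : ∀ l, 0 < κ l)
    (σ : Matrix ((l : ι) → Fin (d l)) ((l : ι) → Fin (d l)) ℂ) :
    ∑ i, ‖localTensor G κ σ i‖ ^ 2 =
      (∏ l, (d l : ℝ)) ^ 2 / (∏ l, κ l) *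
        ∑ j : (l : ι) → Fin (d l ^ 2 - 1), blochWeight G κ σ (fun l => (j l).succ) := by
  rw [Finset.mul_sum]
  refine Finset.sum_congr rfl fun i _ => ?_
  have h1 : ‖∏ l, ((d l : ℂ) / (κ l : ℂ))‖ = (∏ l, (d l : ℝ)) / ∏ l, κ l := by
    rw [norm_prod, ← Finset.prod_div_distrib]
    refine Finset.prod_congr rfl fun l _ => ?_
    rw [norm_div, Complex.norm_natCast, Complex.norm_real, Real.norm_of_nonneg (hκ l).le]
  have hK : ∏ l, κ l ≠ 0 := Finset.prod_ne_zero_iff.2 fun l _ => (hκ l).ne'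
  rw [localTensor, blochWeight, norm_mul, mul_pow, h1]
  simp only [basisWeight, Fin.succ_ne_zero, if_false]
  field_simp

end CorrelationNorm

/-- The squared norm is `(D²/K) E`, and the three branches of `mConst` are `D²/K` times the three
bounds on `E`. -/
theorem sum_sq_norm_localTensor_le_mConst {N : ℕ} {d : Fin N → ℕ} {κ : Fin N → ℝ}
    (hκ : ∀ l, 0 < κ l)
    {G : (l : Fin N) → Fin (d l ^ 2 - 1 + 1) → Matrix (Fin (d l)) (Fin (d l)) ℂ}
    (hG : ∀ l, IsOperatorBasis (G l) (κ l)) {S : Finset (Fin N)} (hS : S.Nonempty)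
    {σ : Matrix ((l : S) → Fin (d l)) ((l : S) → Fin (d l)) ℂ} (hσ : IsPureState σ) :
    ∑ i, ‖localTensor (ι := S) (d := fun l => d l) (fun l => G l) (fun l => κ l) σ i‖ ^ 2 ≤
      mConst d κ S := by
  -- A unit vector exists only on a nonempty index set, so the local dimensions are positive.
  have hd : ∀ l : S, 0 < d l := fun l => Fin.pos (hσ.nonempty.some l)
  have hκ' : ∀ l : S, 0 < κ l := fun l => hκ l
  have hG' : ∀ l : S, IsOperatorBasis (G l) (κ l) := fun l => hG l
  have hne : Nonempty S := hS.to_subtype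
  have e1 := sum_blochWeight_succ_le hd hκ' hG' hσ
  have e2 := card_sub_one_mul_sum_blochWeight_succ_le hd hκ' hG' hσ
  have e3 := card_sub_two_mul_sum_blochWeight_succ_le hd hκ' hG' (σ := σ)
  rw [sum_sq_norm_localTensor hκ']
  have hD0 : 0 < ∏ l : S, (d l : ℝ) := Finset.prod_pos fun l _ => by exact_mod_cast hd l
  have hK0 : 0 < ∏ l : S, κ l := Finset.prod_pos fun l _ => hκ l
  set E := ∑ j : (l : S) → Fin (d l ^ 2 - 1), blochWeight (fun l : S => G l) (fun l => κ l) σ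
    (fun l => (j l).succ)
  simp only [Fintype.card_coe, Finset.prod_coe_sort S fun l => (d l : ℝ),
    Finset.prod_coe_sort S κ, Finset.sum_coe_sort S fun l => 1 / (d l : ℝ) ^ 2] at *
  have hcard : 1 ≤ S.card := hS.card_pos
  have hdmax : ∀ l ∈ S, (d l : ℝ) ^ 2 ≤ (S.sup d : ℕ) ^ 2 := fun l hl => by
    have : d l ≤ S.sup d := Finset.le_sup hl
    gcongr
  have hdpos : 0 < S.sup d := by
    obtain ⟨l, hl⟩ := hS
    exact (hd ⟨l, hl⟩).trans_le (Finset.le_sup hl)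
  unfold mConst
  simp only
  split_ifs with h1 h2
  · obtain ⟨l, rfl⟩ := Finset.card_eq_one.1 h1
    simp only [Finset.prod_singleton, Finset.sum_singleton] at *
    calc (d l : ℝ) ^ 2 / κ l * E ≤ (d l : ℝ) ^ 2 / κ l * (1 - (d l : ℝ)⁻¹) := by gcongr
      _ = _ := by field_simp
  · have hk : (0 : ℝ) < (S.card : ℝ) - 1 := by
      rw [sub_pos]; exact_mod_cast (show 1 < S.card by omega)
    have e2' := (le_div_iff₀' hk).2 e2
    refine (mul_le_mul_of_nonneg_left e2' (by positivity)).trans_eq ?_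
    field_simp
  · have hk3 : 3 ≤ S.card := by
      have : S.card ≠ 2 := fun h => h2 (Or.inl h)
      omega
    have hk : (0 : ℝ) < (S.card : ℝ) - 2 := by
      rw [sub_pos]; exact_mod_cast hk3
    -- The failed branch condition says `D ≥ dmax²`, which dominates every `d_l²`.
    have hD : ∀ l : S, (d l : ℝ) ^ 2 ≤ ∏ l ∈ S, (d l : ℝ) := fun l => by
      have := not_lt.1 (not_or.1 h2).2
      rw [one_le_div (by positivity)] at this
      exact (hdmax l l.2).trans this
    have e3' := (le_div_iff₀' hk).2 (e3 (by omega) hD hσ)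
    refine (mul_le_mul_of_nonneg_left e3' (by positivity)).trans_eq ?_
    field_simp

/-! ### Factorization of the extended tensor on product states -/

section ProductStates

variable {N : ℕ} {d : Fin N → ℕ}

theorem prod_eq_prod_mul_prod_compl (S : Finset (Fin N)) (g : Fin N → ℂ) :
    ∏ l, g l = (∏ l : S, g l) * ∏ l : (Sᶜ : Finset (Fin N)), g l := by
  rw [Finset.prod_coe_sort S g, Finset.prod_coe_sort Sᶜ g, Finset.prod_mul_prod_compl]

/-- A multi-index is a pair of multi-indices on `S` and on its complement. -/
def combineEquiv (D : Fin N → ℕ) (S : Finset (Fin N)) :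
    (((l : S) → Fin (D l)) × ((l : (Sᶜ : Finset (Fin N))) → Fin (D l))) ≃
      ((l : Fin N) → Fin (D l)) where
  toFun a := combine a.1 a.2
  invFun x := (fun l => x l, fun l => x l)
  left_inv a := by
    ext l
    · simp [combine]
    · simp [combine, Finset.mem_compl.1 l.2]
  right_inv x := by
    ext l
    simp [combine]

theorem trace_bipartiteProd_mul_tensorOp {S : Finset (Fin N)}
    (A : Matrix ((l : S) → Fin (d l)) ((l : S) → Fin (d l)) ℂ)
    (B : Matrix ((l : (Sᶜ : Finset (Fin N))) → Fin (d l))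
      ((l : (Sᶜ : Finset (Fin N))) → Fin (d l)) ℂ)
    (O : (l : Fin N) → Matrix (Fin (d l)) (Fin (d l)) ℂ) :
    Matrix.trace (bipartiteProd A B * tensorOp O) =
      Matrix.trace (A * piTensor fun l : S => O l) *
        Matrix.trace (B * piTensor fun l : (Sᶜ : Finset (Fin N)) => O l) := by
  have hsum : ∀ F : ((l : Fin N) → Fin (d l)) → ℂ,
      ∑ x, F x = ∑ a, ∑ b, F (combineEquiv d S (a, b)) := fun F => by
    rw [← Equiv.sum_comp (combineEquiv d S), Fintype.sum_prod_type]
  have h1 : ∀ a b (l : S), combineEquiv d S (a, b) l = a l := fun a b l => by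
    simp [combineEquiv, combine]
  have h2 : ∀ a b (l : (Sᶜ : Finset (Fin N))), combineEquiv d S (a, b) l = b l := fun a b l => by
    simp [combineEquiv, combine, Finset.mem_compl.1 l.2]
  simp only [Matrix.trace, Matrix.diag_apply, Matrix.mul_apply, hsum, bipartiteProd, tensorOp,
    piTensor, prod_eq_prod_mul_prod_compl S, h1, h2]
  rw [Finset.sum_mul_sum]
  refine Finset.sum_congr rfl fun a _ => Finset.sum_congr rfl fun b _ => ?_
  rw [Finset.sum_mul_sum]
  exact Finset.sum_congr rfl fun a' _ => Finset.sum_congr rfl fun b' _ => by ring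

variable {G : (l : Fin N) → Fin (d l ^ 2 - 1 + 1) → Matrix (Fin (d l)) (Fin (d l)) ℂ}
  {κ : Fin N → ℝ} {S : Finset (Fin N)}
  {A : Matrix ((l : S) → Fin (d l)) ((l : S) → Fin (d l)) ℂ}
  {B : Matrix ((l : (Sᶜ : Finset (Fin N))) → Fin (d l))
      ((l : (Sᶜ : Finset (Fin N))) → Fin (d l)) ℂ}

theorem reducedTensor_bipartiteProd_left (hB : B.trace = 1) (i : (l : S) → Fin (d l ^ 2 - 1)) :
    reducedTensor G κ (bipartiteProd A B) S i =
      localTensor (fun l : S => G l) (fun l => κ l) A i := by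
  rw [reducedTensor, trace_bipartiteProd_mul_tensorOp, localTensor,
    ← Finset.prod_coe_sort S fun l => (d l : ℂ) / (κ l : ℂ)]
  have h1 : (fun l : S => if h : (l : Fin N) ∈ S then G l (i ⟨l, h⟩).succ else 1) =
      fun l : S => G l (i l).succ := by
    funext l
    simp
  have h2 : (fun l : (Sᶜ : Finset (Fin N)) =>
      if h : (l : Fin N) ∈ S then G l (i ⟨l, h⟩).succ else 1) = fun l => 1 := by
    funext l
    simp [Finset.mem_compl.1 l.2]
  rw [h1, h2, piTensor_one, mul_one, hB, mul_one]

theorem reducedTensor_bipartiteProd_right (hA : A.trace = 1)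
    (i : (l : (Sᶜ : Finset (Fin N))) → Fin (d l ^ 2 - 1)) :
    reducedTensor G κ (bipartiteProd A B) Sᶜ i =
      localTensor (fun l : (Sᶜ : Finset (Fin N)) => G l) (fun l => κ l) B i := by
  rw [reducedTensor, trace_bipartiteProd_mul_tensorOp, localTensor,
    ← Finset.prod_coe_sort Sᶜ fun l => (d l : ℂ) / (κ l : ℂ)]
  have h1 : (fun l : (Sᶜ : Finset (Fin N)) =>
      if h : (l : Fin N) ∈ Sᶜ then G l (i ⟨l, h⟩).succ else 1) =
        fun l : (Sᶜ : Finset (Fin N)) => G l (i l).succ := by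
    funext l
    rw [dif_pos l.2]
  have h2 : (fun l : S => if h : (l : Fin N) ∈ Sᶜ then G l (i ⟨l, h⟩).succ else 1) =
      fun l => 1 := by
    funext l
    rw [dif_neg (by simp)]
  rw [h1, h2, piTensor_one, mul_one, hA, one_mul]

theorem correlationTensor_bipartiteProd (a : (l : S) → Fin (d l ^ 2 - 1))
    (b : (l : (Sᶜ : Finset (Fin N))) → Fin (d l ^ 2 - 1)) :
    correlationTensor G κ (bipartiteProd A B) (combine (D := fun l => d l ^ 2 - 1) a b) =
      localTensor (fun l : S => G l) (fun l => κ l) A a *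
        localTensor (fun l : (Sᶜ : Finset (Fin N)) => G l) (fun l => κ l) B b := by
  rw [correlationTensor, trace_bipartiteProd_mul_tensorOp, localTensor, localTensor,
    prod_eq_prod_mul_prod_compl S]
  have h1 : (fun l : S => G l (combine (D := fun l => d l ^ 2 - 1) a b l).succ) =
      fun l : S => G l (a l).succ := by
    funext l
    simp [combine]
  have h2 : (fun l : (Sᶜ : Finset (Fin N)) =>
      G l (combine (D := fun l => d l ^ 2 - 1) a b l).succ) =
        fun l : (Sᶜ : Finset (Fin N)) => G l (b l).succ := by
    funext l
    simp [combine, Finset.mem_compl.1 l.2]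
  rw [h1, h2]
  ring

theorem reducedTensor_sum {r : Type*} [Fintype r] (c : r → ℂ)
    (ρ : r → Matrix ((l : Fin N) → Fin (d l)) ((l : Fin N) → Fin (d l)) ℂ) (S : Finset (Fin N))
    (i : (l : S) → Fin (d l ^ 2 - 1)) :
    reducedTensor G κ (∑ j, c j • ρ j) S i = ∑ j, c j * reducedTensor G κ (ρ j) S i := by
  simp only [reducedTensor, Finset.sum_mul, Matrix.smul_mul, Matrix.trace_sum, Matrix.trace_smul,
    smul_eq_mul, Finset.mul_sum, mul_left_comm]

theorem correlationTensor_sum {r : Type*} [Fintype r] (c : r → ℂ)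
    (ρ : r → Matrix ((l : Fin N) → Fin (d l)) ((l : Fin N) → Fin (d l)) ℂ)
    (i : (l : Fin N) → Fin (d l ^ 2 - 1)) :
    correlationTensor G κ (∑ j, c j • ρ j) i = ∑ j, c j * correlationTensor G κ (ρ j) i := by
  simp only [correlationTensor, Matrix.smul_mul, Matrix.trace_sum, Matrix.trace_smul,
    smul_eq_mul, Finset.mul_sum, Matrix.sum_mul, mul_left_comm]

/-- The vector `(u, α ⊗ t)`. -/
def extendedVec {p q : ℕ} {P : Type*} (u : EuclideanSpace ℝ (Fin p))
    (α : EuclideanSpace ℝ (Fin q)) (t : P → ℂ) : Fin p ⊕ Fin q × P → ℂ :=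
  Sum.elim (fun i => (u i : ℂ)) (vecKron α t)

theorem sum_sq_norm_extendedVec {p q : ℕ} {P : Type*} [Fintype P] (u : EuclideanSpace ℝ (Fin p))
    (α : EuclideanSpace ℝ (Fin q)) (t : P → ℂ) :
    ∑ x, ‖extendedVec u α t x‖ ^ 2 = ‖u‖ ^ 2 + ‖α‖ ^ 2 * ∑ x, ‖t x‖ ^ 2 := by
  simp [extendedVec, vecKron, Fintype.sum_prod_type, EuclideanSpace.norm_sq_eq, mul_pow,
    Finset.sum_mul_sum]

theorem sum_sq_norm_modeVec {D : Fin N → ℕ} {S : Finset (Fin N)} (n : Fin S.card)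
    (t : ((l : S) → Fin (D l)) → ℂ) : ∑ x, ‖modeVec n t x‖ ^ 2 = ∑ i, ‖t i‖ ^ 2 :=
  Equiv.sum_comp (modePos D S n).symm fun i => ‖t i‖ ^ 2

/-- The extended correlation tensor of a convex combination of product states. -/
theorem extendedTensor_sum_bipartiteProd {r : Type*} [Fintype r] {p : r → ℝ} (hp : ∑ j, p j = 1)
    {A : r → Matrix ((l : S) → Fin (d l)) ((l : S) → Fin (d l)) ℂ}
    {B : r → Matrix ((l : (Sᶜ : Finset (Fin N))) → Fin (d l))
      ((l : (Sᶜ : Finset (Fin N))) → Fin (d l)) ℂ}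
    (hA : ∀ j, (A j).trace = 1) (hB : ∀ j, (B j).trace = 1) (n : Fin S.card) (m : Fin (Sᶜ).card)
    {p₁ p₂ q₁ q₂ : ℕ} (u : EuclideanSpace ℝ (Fin p₁)) (v : EuclideanSpace ℝ (Fin p₂))
    (α : EuclideanSpace ℝ (Fin q₁)) (β : EuclideanSpace ℝ (Fin q₂)) :
    extendedTensor G κ (∑ j, (p j : ℂ) • bipartiteProd (A j) (B j)) S n m u v α β =
      ∑ j, (p j : ℂ) • Matrix.vecMulVec
        (extendedVec u α (modeVec (D := fun l => d l ^ 2 - 1) n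
          (localTensor (fun l : S => G l) (fun l => κ l) (A j))))
        (extendedVec v β (modeVec (D := fun l => d l ^ 2 - 1) m
          (localTensor (fun l : (Sᶜ : Finset (Fin N)) => G l) (fun l => κ l) (B j)))) := by
  have hp' : ∑ j, (p j : ℂ) = 1 := by exact_mod_cast hp
  ext (a | a) (b | b)
  · simp only [extendedTensor, Matrix.fromBlocks_apply₁₁, Matrix.sum_apply, Matrix.smul_apply,
      extendedVec, Matrix.vecMulVec_apply, Sum.elim_inl, smul_eq_mul]
    -- The block `u vᵀ` does not depend on the state, so it is recovered because the weights sum to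
    -- `1`; the other blocks are linear in the state.
    rw [← Finset.sum_mul, hp', one_mul]
  · simp only [extendedTensor, Matrix.fromBlocks_apply₁₂, Matrix.sum_apply, Matrix.smul_apply,
      extendedVec, Matrix.vecMulVec_apply, vecKron, modeVec, reducedTensor_sum, Sum.elim_inl,
      Sum.elim_inr, reducedTensor_bipartiteProd_right (hA _), Finset.mul_sum, smul_eq_mul]
    exact Finset.sum_congr rfl fun j _ => by ring
  · simp only [extendedTensor, Matrix.fromBlocks_apply₂₁, Matrix.sum_apply, Matrix.smul_apply,
      extendedVec, Matrix.vecMulVec_apply, vecKron, modeVec, reducedTensor_sum, Sum.elim_inl,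
      Sum.elim_inr, reducedTensor_bipartiteProd_left (hB _), Finset.mul_sum, Finset.sum_mul,
      smul_eq_mul]
    exact Finset.sum_congr rfl fun j _ => by ring
  · simp only [extendedTensor, Matrix.fromBlocks_apply₂₂, Matrix.sum_apply, Matrix.smul_apply,
      extendedVec, Matrix.vecMulVec_apply, vecKron, modeVec, correlationTensor_sum, Sum.elim_inr,
      Matrix.kroneckerMap_apply, mixedUnfold, correlationTensor_bipartiteProd, Finset.mul_sum,
      smul_eq_mul]
    exact Finset.sum_congr rfl fun j _ => by ring

end ProductStates

end Bisep

end

theorem theorem4 {N : ℕ} (d : Fin N → ℕ) (κ : Fin N → ℝ) (hκ : ∀ l, 1 ≤ κ l)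
    (G : (l : Fin N) → Fin (d l ^ 2 - 1 + 1) → Matrix (Fin (d l)) (Fin (d l)) ℂ)
    (hG : ∀ l, Bisep.IsOperatorBasis (G l) (κ l))
    (S : Finset (Fin N)) (n : Fin S.card) (m : Fin (Sᶜ).card)
    (ρ : Matrix ((l : Fin N) → Fin (d l)) ((l : Fin N) → Fin (d l)) ℂ)
    (hρ : Bisep.IsBiseparable S ρ)
    {p₁ p₂ q₁ q₂ : ℕ} (u : EuclideanSpace ℝ (Fin p₁)) (v : EuclideanSpace ℝ (Fin p₂))
    (α : EuclideanSpace ℝ (Fin q₁)) (β : EuclideanSpace ℝ (Fin q₂)) :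
    Bisep.traceNorm (Bisep.extendedTensor G κ ρ S n m u v α β) ≤
      √(‖u‖ ^ 2 + ‖α‖ ^ 2 * Bisep.mConst d κ S) *
        √(‖v‖ ^ 2 + ‖β‖ ^ 2 * Bisep.mConst d κ Sᶜ) := by
  obtain ⟨r, p, A, B, hp, hp1, hA, hB, rfl⟩ := hρ
  have hκ' : ∀ l, 0 < κ l := fun l => one_pos.trans_le (hκ l)
  have hS : S.Nonempty := Finset.card_pos.1 n.pos
  have hSc : Sᶜ.Nonempty := Finset.card_pos.1 m.pos
  rw [Bisep.extendedTensor_sum_bipartiteProd hp1 (fun j => (hA j).trace_eq_one)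
    (fun j => (hB j).trace_eq_one)]
  refine (Bisep.traceNorm_sum_vecMulVec_le hp _ _).trans ?_
  -- The bound is spread over the weights `p j`, so that it can be compared term by term.
  rw [← one_mul (√_ * √_), ← hp1, Finset.sum_mul]
  refine Finset.sum_le_sum fun j _ => mul_le_mul_of_nonneg_left ?_ (hp j)
  rw [Bisep.sum_sq_norm_extendedVec, Bisep.sum_sq_norm_extendedVec,
    Bisep.sum_sq_norm_modeVec (D := fun l => d l ^ 2 - 1),
    Bisep.sum_sq_norm_modeVec (D := fun l => d l ^ 2 - 1)]
  have hR := Bisep.sum_sq_norm_localTensor_le_mConst hκ' hG hS (hA j)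
  have hC := Bisep.sum_sq_norm_localTensor_le_mConst hκ' hG hSc (hB j)
  gcongr
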